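/- Let $f:\mathbb R\to\mathbb R$ be continuous and $1$-periodic with minimum $f_{\min}>0$ and maximum $f_{\max}$, let $$a_k=\int_{-1/2}^{1/2} f(\omega)e^{2\pi i\omega k}\,d\omega\qquad(k\in\mathbb Z),$$ and assume $|a_k|\le c\,e^{-\gamma|k|}$ for all $k\in\mathbb Z$, with constants $c,\gamma>0$. For $n\in\mathbb N$ let $A_n=[a_{k-l}]_{k,l=0}^{n-1}$; these Toeplitz matrices are hermitian positive definite because $f_{\min}>0$. Let $B_n$ be the $n\times n$ Toeplitz matrix with first row $(b_0,a_{n-1},\dots,a_1)$ and first column $(b_0,a_{-(n-1)},\dots,a_{-1})^{T}$, where $b_0=a_n$ or $b_0=0$ (either convention), and let $$C_{2n}=\begin{bmatrix}A_n & B_n^{*}\\ B_n & A_n\end{bmatrix}$$ (a circulant matrix when $b_0$ is real). Whenever $C_{2n}$ is invertible, the leading $n\times n$ block of $C_{2n}^{-1}$ is invertible, and $S_n$ denotes the inverse of that block. For $y^{(n)}\in\mathbb C^n$ with $|y^{(n)}_k|\le c'e^{-\gamma|n/2-k|}$ for $k=0,\dots,n-1$ (with a constant $c'\ge 0$) let $x^{(n)}$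 and $z^{(n)}$ be the solutions of $A_nx^{(n)}=y^{(n)}$ and $S_nz^{(n)}=y^{(n)}$, and consider the estimate $$\|x^{(n)}-z^{(n)}\|_2\le c'\,c_1\,e^{-\gamma_1 n}.\qquad(*)$$ There is a function $K:\mathbb R^3\to\mathbb R$ such that, with $c_1=K(f_{\min},f_{\max},\gamma_1)$, the following two statements hold. (i) For every such $f$, $c$, $\gamma$ there is a $\gamma_1$ with $0<\gamma_1<\gamma$ such that $(*)$ holds for all $n$ for which $C_{2n}$ is invertible, all admissible choices of $b_0$, all $c'\ge0$ and all $y^{(n)}$ as above. (ii) For all values of $f_{\min}>0$, $f_{\max}$, $c$, $\gamma$ there are $\gamma_1$ with $0<\gamma_1<\gamma$ and $N\in\mathbb N$, depending only on $f_{\min},f_{\max},c,\gamma$, such that for every $f$ with these parameters $(*)$ holds for all $n\ge N$ for which $C_{2n}$ is invertible, all admissible choices of $b_0$, all $c'\ge0$ and all $y^{(n)}$ as above. -/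

import Mathlib

open scoped Matrix

noncomputable section

/-- The Fourier coefficients `a_k = ∫_{-1/2}^{1/2} f(ω) e^{2πiωk} dω` of a real function `f`. -/
def fourierCoefficient (f : ℝ → ℝ) (k : ℤ) : ℂ :=
  ∫ ω in (-(1 / 2 : ℝ))..(1 / 2 : ℝ),
    (f ω : ℂ) * Complex.exp (2 * (Real.pi : ℂ) * Complex.I * (ω : ℂ) * (k : ℂ))

/-- The `n × n` Toeplitz matrix `A_n` with entries `a_{k-l}`, `0 ≤ k, l < n`. -/
def toeplitzSection (a : ℤ → ℂ) (n : ℕ) : Matrix (Fin n) (Fin n) ℂ :=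
  Matrix.of fun k l => a ((k : ℤ) - (l : ℤ))

/-- The `n × n` Toeplitz matrix `B_n` with first row `(b₀, a_{n-1}, …, a_1)` and first column
`(b₀, a_{-(n-1)}, …, a_{-1})`. -/
def cornerBlock (a : ℤ → ℂ) (b₀ : ℂ) (n : ℕ) : Matrix (Fin n) (Fin n) ℂ :=
  Matrix.of fun k l =>
    if k = l then b₀
    else if k < l then a ((n : ℤ) - ((l : ℤ) - (k : ℤ)))
    else a (((k : ℤ) - (l : ℤ)) - (n : ℤ))

/-- The `2n × 2n` embedding `C_{2n} = [A_n, B_nᴴ; B_n, A_n]` of `A_n`. -/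
def circulantEmbedding (a : ℤ → ℂ) (b₀ : ℂ) (n : ℕ) :
    Matrix (Fin n ⊕ Fin n) (Fin n ⊕ Fin n) ℂ :=
  Matrix.fromBlocks (toeplitzSection a n) (cornerBlock a b₀ n)ᴴ
    (cornerBlock a b₀ n) (toeplitzSection a n)

/-- `S_n`, the inverse of the leading `n × n` block of `C_{2n}⁻¹`. When `A_n` and `C_{2n}` are
invertible that block is invertible too (Schur complement), so the inverse is a genuine one. -/
def embeddingApprox (a : ℤ → ℂ) (b₀ : ℂ) (n : ℕ) : Matrix (Fin n) (Fin n) ℂ :=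
  ((circulantEmbedding a b₀ n)⁻¹.toBlocks₁₁)⁻¹

/-- `f` is a continuous, real, `1`-periodic symbol with minimum `m`, maximum `M`, and
`|a_k| ≤ c e^{-γ|k|}` for all `k ∈ ℤ`. -/
structure IsExpDecaySymbol (f : ℝ → ℝ) (m M c γ : ℝ) : Prop where
  continuous : Continuous f
  periodic : Function.Periodic f 1
  isLeast : IsLeast (Set.range f) m
  isGreatest : IsGreatest (Set.range f) M
  decay : ∀ k : ℤ, ‖fourierCoefficient f k‖ ≤ c * Real.exp (-γ * |(k : ℝ)|)

/-- For the symbol `f` and dimension `n` (with either convention `b₀ = a_n` or `b₀ = 0`): if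
`C_{2n}` is invertible, then every `y` with `|y_k| ≤ c' e^{-γ|n/2-k|}` and the solutions of
`A_n x = y`, `S_n z = y` satisfy `‖x - z‖₂ ≤ c' c₁ e^{-γ₁ n}`. -/
def EmbeddingErrorBound (f : ℝ → ℝ) (γ γ₁ c₁ : ℝ) (n : ℕ) : Prop :=
  ∀ b₀ : ℂ, b₀ = fourierCoefficient f n ∨ b₀ = 0 →
    IsUnit (circulantEmbedding (fourierCoefficient f) b₀ n) →
    ∀ c' : ℝ, 0 ≤ c' → ∀ x y z : Fin n → ℂ,
      (∀ k : Fin n, ‖y k‖ ≤ c' * Real.exp (-γ * |(n : ℝ) / 2 - ((k : ℕ) : ℝ)|)) →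
      toeplitzSection (fourierCoefficient f) n *ᵥ x = y →
      embeddingApprox (fourierCoefficient f) b₀ n *ᵥ z = y →
      ‖WithLp.toLp 2 (x - z)‖ ≤ c' * c₁ * Real.exp (-γ₁ * (n : ℝ))

end

/-!
The error is governed by a single vector. If `A x = y` and `S z = y`, then the Schur complement
gives `w` with `C (z, w) = (y, 0)`, while `C (x, 0) = (y, B x)`. Subtracting,
`C (x - z, -w) = (0, B x)`, so `‖x - z‖ ≤ ‖C⁻¹‖ ‖B x‖` (`norm_sub_le_of_circulantEmbedding`).

*The vector `B x` is exponentially small.* Conjugating `A` by the diagonal matrix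
`e^{δ|n/2 - k|}` with small `δ` perturbs it by a matrix whose Schur test bound is at most `m/4`, so
the conjugated matrix is still coercive and `x = A⁻¹ y` decays like `e^{-δ|n/2 - k|}` along with `y`
(`weighted_norm_apply_le`). The entries of `B` decay away from the two corners in which it is
large, and these corners only see the small ends of `x` (`norm_cornerBlock_mulVec_le`).

*The inverse of `C` is bounded.* For `b₀ = 0` the embedding is the circulant matrix whose
eigenvalues are the values at `q/2n` of the Fourier series of `f` truncated to `|k| < n`. The
truncation is exponentially close to `f ≥ m`, and a nonzero `b₀` is an exponentially small
perturbation, so `C` is coercive with constant `m/2` for all large `n`, uniformly in `f`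
(`isCoercive_circulantEmbedding`). The same computation in a larger circulant matrix shows that
every `A_n` is coercive (`isCoercive_toeplitzSection`). For the finitely many small `n` the norm of
`C⁻¹` is just some finite number depending on `f`.

This yields a bound `W c' e^{-δn}` with `W` independent of `n`. Since the admissible constant
`K m M γ₁` may depend on the rate, `γ₁⁻¹` serves as `K`: decreasing `γ₁` weakens the exponential and
makes `γ₁⁻¹` exceed `W`.
-/

/-! ### Coercive matrices -/

/-- The real part of the quadratic form of `A` is at least `μ` times the squared Euclidean norm.
The matrix is not required to be hermitian. -/
def Matrix.IsCoercive {ι : Type*} [Fintype ι] (A : Matrix ι ι ℂ) (μ : ℝ) : Prop :=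
  ∀ v : ι → ℂ, μ * ∑ i, ‖v i‖ ^ 2 ≤ (star v ⬝ᵥ (A *ᵥ v)).re

theorem norm_toLp_sq {ι : Type*} [Fintype ι] (v : ι → ℂ) :
    ‖WithLp.toLp 2 v‖ ^ 2 = ∑ i, ‖v i‖ ^ 2 := by
  rw [EuclideanSpace.norm_sq_eq]

theorem Matrix.IsCoercive.norm_le {ι : Type*} [Fintype ι] {A : Matrix ι ι ℂ} {μ : ℝ}
    (h : Matrix.IsCoercive A μ) (v : ι → ℂ) :
    μ * ‖WithLp.toLp 2 v‖ ≤ ‖WithLp.toLp 2 (A *ᵥ v)‖ := by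
  have h1 := h v
  rw [← norm_toLp_sq] at h1
  have h2 : (star v ⬝ᵥ (A *ᵥ v)).re ≤ ‖WithLp.toLp 2 v‖ * ‖WithLp.toLp 2 (A *ᵥ v)‖ := by
    rw [dotProduct_comm, ← EuclideanSpace.inner_toLp_toLp]
    exact (Complex.re_le_norm _).trans (norm_inner_le_norm _ _)
  rcases (norm_nonneg (WithLp.toLp 2 v)).eq_or_lt with h0 | h0
  · rw [← h0]; simp
  · refine le_of_mul_le_mul_left ?_ h0
    linarith

theorem Matrix.IsCoercive.mulVec_eq_zero {ι : Type*} [Fintype ι] {A : Matrix ι ι ℂ} {μ : ℝ}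
    (h : Matrix.IsCoercive A μ) (hμ : 0 < μ) {v : ι → ℂ} (hv : A *ᵥ v = 0) : v = 0 := by
  have h1 := h.norm_le v
  rw [hv, WithLp.toLp_zero, norm_zero] at h1
  have h2 : ‖WithLp.toLp 2 v‖ = 0 :=
    le_antisymm (nonpos_of_mul_nonpos_right h1 hμ) (norm_nonneg _)
  simpa using norm_eq_zero.mp h2

/-- Schur's test as a perturbation bound: an entrywise perturbation dominated by a symmetric
matrix with row sums at most `η` costs at most `η` of coercivity. -/
theorem Matrix.IsCoercive.of_entrywise_near {ι : Type*} [Fintype ι] {A A' : Matrix ι ι ℂ} {μ η : ℝ}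
    (h : Matrix.IsCoercive A μ) (ε : ι → ι → ℝ) (hsymm : ∀ i j, ε i j = ε j i)
    (hrow : ∀ i, ∑ j, ε i j ≤ η) (hε : ∀ i j, ‖A' i j - A i j‖ ≤ ε i j) :
    Matrix.IsCoercive A' (μ - η) := by
  intro v
  have hsplit : star v ⬝ᵥ (A' *ᵥ v) =
      star v ⬝ᵥ (A *ᵥ v) + ∑ i, ∑ j, star (v i) * ((A' i j - A i j) * v j) := by
    simp only [dotProduct, Matrix.mulVec, Finset.mul_sum, Pi.star_apply]
    rw [← Finset.sum_add_distrib]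
    refine Finset.sum_congr rfl fun i _ => ?_
    rw [← Finset.sum_add_distrib]
    exact Finset.sum_congr rfl fun j _ => by ring
  have hbd : ‖∑ i, ∑ j, star (v i) * ((A' i j - A i j) * v j)‖ ≤ η * ∑ i, ‖v i‖ ^ 2 := by
    calc ‖∑ i, ∑ j, star (v i) * ((A' i j - A i j) * v j)‖
        ≤ ∑ i, ∑ j, ‖star (v i) * ((A' i j - A i j) * v j)‖ :=
          (norm_sum_le _ _).trans (Finset.sum_le_sum fun i _ => norm_sum_le _ _)
      _ ≤ ∑ i, ∑ j, (ε i j * ‖v i‖ ^ 2 / 2 + ε j i * ‖v j‖ ^ 2 / 2) := by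
          refine Finset.sum_le_sum fun i _ => Finset.sum_le_sum fun j _ => ?_
          rw [norm_mul, norm_mul, norm_star, hsymm j i]
          have h0 : 0 ≤ ε i j := (norm_nonneg _).trans (hε i j)
          calc ‖v i‖ * (‖A' i j - A i j‖ * ‖v j‖)
              = ‖A' i j - A i j‖ * (‖v i‖ * ‖v j‖) := by ring
            _ ≤ ε i j * (‖v i‖ * ‖v j‖) := by gcongr; exact hε i j
            _ ≤ ε i j * ((‖v i‖ ^ 2 + ‖v j‖ ^ 2) / 2) := by
                gcongr
                linarith [two_mul_le_add_sq ‖v i‖ ‖v j‖]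
            _ = _ := by ring
      _ = ∑ i, (∑ j, ε i j) * ‖v i‖ ^ 2 := by
          simp only [Finset.sum_add_distrib]
          rw [Finset.sum_comm (f := fun i j => ε j i * ‖v j‖ ^ 2 / 2), ← Finset.sum_add_distrib]
          refine Finset.sum_congr rfl fun i _ => ?_
          rw [← Finset.sum_add_distrib, Finset.sum_mul]
          exact Finset.sum_congr rfl fun j _ => by ring
      _ ≤ η * ∑ i, ‖v i‖ ^ 2 := by
          rw [Finset.mul_sum]
          exact Finset.sum_le_sum fun i _ => by gcongr; exact hrow i
  have h1 := h v
  have h2 := (Complex.abs_re_le_norm (∑ i, ∑ j, star (v i) * ((A' i j - A i j) * v j))).trans hbd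
  rw [hsplit, Complex.add_re]
  have h3 := (abs_le.mp h2).1
  linarith

theorem norm_toLp_le_card_mul {n : ℕ} (v : Fin n → ℂ) {b : ℝ} (hb : 0 ≤ b)
    (h : ∀ i, ‖v i‖ ≤ b) : ‖WithLp.toLp 2 v‖ ≤ n * b := by
  refine le_of_sq_le_sq ?_ (by positivity)
  rw [norm_toLp_sq]
  calc ∑ i, ‖v i‖ ^ 2 ≤ ∑ _i : Fin n, b ^ 2 :=
        Finset.sum_le_sum fun i _ => by gcongr; exact h i
    _ = n * b ^ 2 := by simp
    _ ≤ (n * b) ^ 2 := by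
        rw [mul_pow]
        gcongr
        exact_mod_cast Nat.le_self_pow two_ne_zero n

theorem norm_apply_le_norm_toLp {ι : Type*} [Fintype ι] (v : ι → ℂ) (i : ι) :
    ‖v i‖ ≤ ‖WithLp.toLp 2 v‖ :=
  PiLp.norm_apply_le (WithLp.toLp 2 v) i

theorem exists_norm_le_of_isUnit {ι : Type*} [Fintype ι] [DecidableEq ι] {A : Matrix ι ι ℂ}
    (hA : IsUnit A) :
    ∃ κ : ℝ, 0 ≤ κ ∧
      ∀ v : ι → ℂ, ‖WithLp.toLp 2 v‖ ≤ κ * ‖WithLp.toLp 2 (A *ᵥ v)‖ := by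
  refine ⟨‖Matrix.toEuclideanCLM (n := ι) (𝕜 := ℂ) A⁻¹‖, norm_nonneg _, fun v => ?_⟩
  have h := (Matrix.toEuclideanCLM (n := ι) (𝕜 := ℂ) A⁻¹).le_opNorm (WithLp.toLp 2 (A *ᵥ v))
  rwa [Matrix.toEuclideanCLM_toLp, Matrix.mulVec_mulVec,
    Matrix.nonsing_inv_mul _ ((Matrix.isUnit_iff_isUnit_det _).mp hA), Matrix.one_mulVec] at h

theorem norm_toLp_le_norm_toLp_sumElim {ι κ : Type*} [Fintype ι] [Fintype κ] (u : ι → ℂ)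
    (w : κ → ℂ) : ‖WithLp.toLp 2 u‖ ≤ ‖WithLp.toLp 2 (Sum.elim u w)‖ := by
  refine le_of_sq_le_sq ?_ (norm_nonneg _)
  rw [norm_toLp_sq, norm_toLp_sq, Fintype.sum_sum_type]
  simpa using Finset.sum_nonneg fun i _ => sq_nonneg ‖w i‖

theorem norm_toLp_sumElim_zero {ι κ : Type*} [Fintype ι] [Fintype κ] (w : κ → ℂ) :
    ‖WithLp.toLp 2 (Sum.elim (0 : ι → ℂ) w)‖ = ‖WithLp.toLp 2 w‖ := by
  rw [← sq_eq_sq₀ (norm_nonneg _) (norm_nonneg _), norm_toLp_sq, norm_toLp_sq,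
    Fintype.sum_sum_type]
  simp

/-! ### The Schur complement and the embedding error -/

/-- Applying the inverse of the leading block of `C⁻¹` amounts to solving with `C` and right-hand
side supported in the leading block: if `C` and its lower right block are injective, then
`((C⁻¹)₁₁)⁻¹ z = y` yields `w` with `C (z, w) = (y, 0)`. -/
theorem exists_fromBlocks_mulVec_eq {n : ℕ} {A B B' D : Matrix (Fin n) (Fin n) ℂ}
    (hC : IsUnit (Matrix.fromBlocks A B B' D)) (hD : ∀ v, D *ᵥ v = 0 → v = 0)
    {y z : Fin n → ℂ} (hz : ((Matrix.fromBlocks A B B' D)⁻¹.toBlocks₁₁)⁻¹ *ᵥ z = y) :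
    ∃ w : Fin n → ℂ, Matrix.fromBlocks A B B' D *ᵥ Sum.elim z w = Sum.elim y 0 := by
  set C := Matrix.fromBlocks A B B' D with hCdef
  have hdet := (Matrix.isUnit_iff_isUnit_det _).mp hC
  have hinv : ∀ u : Fin n → ℂ, C⁻¹ *ᵥ Sum.elim u 0 =
      Sum.elim (C⁻¹.toBlocks₁₁ *ᵥ u) (C⁻¹.toBlocks₂₁ *ᵥ u) := by
    intro u
    conv_lhs => rw [← Matrix.fromBlocks_toBlocks C⁻¹]
    rw [Matrix.fromBlocks_mulVec]
    simp
  have hCinv : ∀ u : Fin n → ℂ,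
      C *ᵥ Sum.elim (C⁻¹.toBlocks₁₁ *ᵥ u) (C⁻¹.toBlocks₂₁ *ᵥ u) = Sum.elim u 0 := by
    intro u
    rw [← hinv, Matrix.mulVec_mulVec, Matrix.mul_nonsing_inv _ hdet, Matrix.one_mulVec]
  have hG : IsUnit C⁻¹.toBlocks₁₁ := by
    rw [← Matrix.mulVec_injective_iff_isUnit]
    refine (injective_iff_map_eq_zero (Matrix.mulVecLin C⁻¹.toBlocks₁₁)).mpr fun u hu => ?_
    rw [Matrix.mulVecLin_apply] at hu
    have h1 := hCinv u
    rw [hu, hCdef, Matrix.fromBlocks_mulVec] at h1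
    have h2 : D *ᵥ ((Matrix.fromBlocks A B B' D)⁻¹.toBlocks₂₁ *ᵥ u) = 0 := by
      funext k
      simpa using congrFun h1 (Sum.inr k)
    funext k
    have h3 := congrFun h1 (Sum.inl k)
    rw [← hCdef] at h2
    simpa [← hCdef, hD _ h2] using h3.symm
  have hGdet := (Matrix.isUnit_iff_isUnit_det _).mp hG
  refine ⟨C⁻¹.toBlocks₂₁ *ᵥ y, ?_⟩
  have hzy : z = C⁻¹.toBlocks₁₁ *ᵥ y := by
    rw [← hz, Matrix.mulVec_mulVec, Matrix.mul_nonsing_inv _ hGdet, Matrix.one_mulVec]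
  rw [hzy]
  exact hCinv y

/-- With `A x = y` and `C (z, w) = (y, 0)` one has `C (x - z, -w) = (0, B x)`, so that the
embedding error is controlled by `B x` alone. -/
theorem norm_sub_le_of_circulantEmbedding {a : ℤ → ℂ} {b₀ : ℂ} {n : ℕ} {κ : ℝ}
    (hC : IsUnit (circulantEmbedding a b₀ n))
    (hA : ∀ v, toeplitzSection a n *ᵥ v = 0 → v = 0)
    (hκ : ∀ v, ‖WithLp.toLp 2 v‖ ≤ κ * ‖WithLp.toLp 2 (circulantEmbedding a b₀ n *ᵥ v)‖)
    {x y z : Fin n → ℂ} (hx : toeplitzSection a n *ᵥ x = y)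
    (hz : embeddingApprox a b₀ n *ᵥ z = y) :
    ‖WithLp.toLp 2 (x - z)‖ ≤ κ * ‖WithLp.toLp 2 (cornerBlock a b₀ n *ᵥ x)‖ := by
  obtain ⟨w, hw⟩ := exists_fromBlocks_mulVec_eq hC hA hz
  have hdiff : circulantEmbedding a b₀ n *ᵥ Sum.elim (x - z) (-w) =
      Sum.elim (0 : Fin n → ℂ) (cornerBlock a b₀ n *ᵥ x) := by
    have h1 : Sum.elim (x - z) (-w) = Sum.elim x 0 - Sum.elim z w := by
      ext (i | i) <;> simp
    rw [h1, Matrix.mulVec_sub, circulantEmbedding, hw, Matrix.fromBlocks_mulVec]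
    ext (i | i) <;> simp [hx]
  refine (norm_toLp_le_norm_toLp_sumElim (x - z) (-w)).trans ((hκ _).trans_eq ?_)
  rw [hdiff, norm_toLp_sumElim_zero]

/-! ### The Fourier series of the symbol -/

theorem fourierCoefficient_neg (f : ℝ → ℝ) (k : ℤ) :
    fourierCoefficient f (-k) = star (fourierCoefficient f k) := by
  unfold fourierCoefficient
  rw [← starRingEnd_apply, ← intervalIntegral.intervalIntegral_conj]
  congr 1
  funext ω
  rw [map_mul, Complex.conj_ofReal, ← Complex.exp_conj]
  simp [map_ofNat (starRingEnd ℂ) 2]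

theorem summable_exp_neg_mul_abs {β : ℝ} (hβ : 0 < β) :
    Summable fun k : ℤ => Real.exp (-β * |(k : ℝ)|) := by
  have h : Summable fun k : ℕ => Real.exp (-β * k) := by
    have := Real.summable_exp_nat_mul_iff.mpr (neg_neg_of_pos hβ)
    simpa [mul_comm] using this
  refine Summable.of_nat_of_neg ?_ ?_ <;> simpa using h

/-- The symbol is the sum of its Fourier series. The sign convention of `fourierCoefficient` puts
a minus sign into the exponent here. -/
theorem hasSum_fourierCoefficient {f : ℝ → ℝ} (hf : Continuous f) (hper : Function.Periodic f 1)
    (hsum : Summable (fourierCoefficient f)) (ω : ℝ) :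
    HasSum (fun k : ℤ => fourierCoefficient f k *
      Complex.exp (-(2 * (Real.pi : ℂ) * Complex.I * (ω : ℂ) * (k : ℂ)))) (f ω) := by
  have hper' : Function.Periodic (fun t => (f t : ℂ)) 1 := fun t => by simp [hper t]
  let g : C(AddCircle (1 : ℝ), ℂ) :=
    ⟨hper'.lift, continuous_coinduced_dom.mpr (Complex.continuous_ofReal.comp hf)⟩
  have hg : ∀ t : ℝ, g (t : AddCircle (1 : ℝ)) = f t := fun t => rfl
  have hcoeff : ∀ k : ℤ, fourierCoeff g (-k) = fourierCoefficient f k := by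
    intro k
    rw [fourierCoeff_eq_intervalIntegral _ _ (-(1 / 2)), fourierCoefficient]
    norm_num
    refine intervalIntegral.integral_congr fun t _ => ?_
    simp only [hg]
    rw [mul_comm]
    congr 2
    ring
  have hsum' : Summable (fourierCoeff g) := by
    rw [← (Equiv.neg ℤ).summable_iff]
    exact hsum.congr fun k => (hcoeff k).symm
  have h := has_pointwise_sum_fourier_series_of_summable hsum' (ω : AddCircle (1 : ℝ))
  rw [← (Equiv.neg ℤ).hasSum_iff, hg] at h
  refine h.congr_fun fun k => ?_
  simp only [Function.comp, Equiv.neg_apply, hcoeff, fourier_coe_apply, smul_eq_mul]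
  congr 2
  push_cast
  ring

/-- The truncated Fourier series `∑_{|k| < L} a_k e^{-2πiωk}`. -/
noncomputable def truncatedSymbol (a : ℤ → ℂ) (L : ℕ) (ω : ℝ) : ℂ :=
  ∑ k ∈ Finset.Ioo (-(L : ℤ)) L,
    a k * Complex.exp (-(2 * (Real.pi : ℂ) * Complex.I * (ω : ℂ) * (k : ℂ)))

/-- Outside `|k| < L` the factor `e^{-γ|k|}` is at most `e^{-γL/2} e^{-γ|k|/2}`, so the truncation
error decays like `e^{-γL/2}`. -/
theorem norm_sub_truncatedSymbol_le {f : ℝ → ℝ} (hf : Continuous f)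
    (hper : Function.Periodic f 1) {c γ : ℝ} (hc : 0 ≤ c) (hγ : 0 < γ)
    (ha : ∀ k : ℤ, ‖fourierCoefficient f k‖ ≤ c * Real.exp (-γ * |(k : ℝ)|)) (L : ℕ) (ω : ℝ) :
    ‖(f ω : ℂ) - truncatedSymbol (fourierCoefficient f) L ω‖ ≤
      c * Real.exp (-(γ / 2) * L) * ∑' k : ℤ, Real.exp (-(γ / 2) * |(k : ℝ)|) := by
  have hsum : Summable (fourierCoefficient f) :=
    Summable.of_norm_bounded ((summable_exp_neg_mul_abs hγ).mul_left c) ha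
  have h := hasSum_fourierCoefficient hf hper hsum ω
  set s := Finset.Ioo (-(L : ℤ)) L
  set F : ℤ → ℂ := fun k => fourierCoefficient f k *
      Complex.exp (-(2 * (Real.pi : ℂ) * Complex.I * (ω : ℂ) * (k : ℂ))) with hF
  have hnorm : ∀ k, ‖F k‖ = ‖fourierCoefficient f k‖ := by
    intro k
    have : -(2 * (Real.pi : ℂ) * Complex.I * (ω : ℂ) * (k : ℂ)) =
        ((-(2 * Real.pi * ω * k) : ℝ) : ℂ) * Complex.I := by push_cast; ring
    rw [hF]
    simp only [norm_mul, this, Complex.norm_exp_ofReal_mul_I, mul_one]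
  have hrest : HasSum (fun k => F k - if k ∈ s then F k else 0)
      ((f ω : ℂ) - truncatedSymbol (fourierCoefficient f) L ω) := by
    refine HasSum.sub h ?_
    have : HasSum (fun k => if k ∈ s then F k else 0) (∑ k ∈ s, if k ∈ s then F k else 0) :=
      hasSum_sum_of_ne_finset_zero fun k hk => if_neg hk
    rwa [Finset.sum_congr rfl (fun k hk => if_pos hk)] at this
  have hS := summable_exp_neg_mul_abs (half_pos hγ)
  rw [← tsum_mul_left]
  refine hrest.norm_le_of_bounded (hS.mul_left _).hasSum fun k => ?_
  split_ifs with hk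
  · rw [sub_self, norm_zero]; positivity
  · rw [sub_zero, hnorm]
    refine (ha k).trans ?_
    rw [mul_assoc, ← Real.exp_add]
    have hk' : (L : ℝ) ≤ |(k : ℝ)| := by
      have : (L : ℤ) ≤ |k| := by
        by_contra! hlt
        exact hk (Finset.mem_Ioo.mpr (abs_lt.mp hlt))
      exact_mod_cast this
    gcongr
    nlinarith

/-! ### Circulant matrices -/

/-- A matrix with entries `ĝ(θᵢ - θⱼ)`, where `ĝ` is the discrete Fourier transform of a function
`F` on `ℤ/P` with real part at least `μ`, is coercive: its quadratic form is the average of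
`F(q) |∑ⱼ vⱼ e(-qθⱼ)|²`, and for constant `F` this is Parseval's identity. -/
theorem isCoercive_of_zmod_fourier {ι : Type*} [Fintype ι] {P : ℕ} [NeZero P] {θ : ι → ZMod P}
    (hθ : Function.Injective θ) {F : ZMod P → ℂ} {μ : ℝ} (hF : ∀ q, μ ≤ (F q).re) :
    Matrix.IsCoercive (Matrix.of fun i j =>
      (P : ℂ)⁻¹ * ∑ q, F q * ZMod.stdAddChar (q * (θ i - θ j))) μ := by
  classical
  intro v
  set w : ZMod P → ℂ := fun q => ∑ j, v j * ZMod.stdAddChar (-(q * θ j)) with hw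
  have hform : ∀ H : ZMod P → ℂ, (∑ i, ∑ j, star (v i) *
      (((P : ℂ)⁻¹ * ∑ q, H q * ZMod.stdAddChar (q * (θ i - θ j))) * v j)) =
      (P : ℂ)⁻¹ * ∑ q, H q * ((‖w q‖ ^ 2 : ℝ) : ℂ) := by
    intro H
    have hnorm : ∀ q, ((‖w q‖ ^ 2 : ℝ) : ℂ) =
        ∑ i, ∑ j, star (v i) * ZMod.stdAddChar (q * (θ i - θ j)) * v j := by
      intro q
      rw [Complex.ofReal_pow, ← Complex.conj_mul', hw]
      simp only [map_sum, map_mul, ← AddChar.map_neg_eq_conj, neg_neg, Finset.sum_mul_sum]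
      refine Finset.sum_congr rfl fun i _ => Finset.sum_congr rfl fun j _ => ?_
      rw [mul_sub, sub_eq_add_neg, AddChar.map_add_eq_mul, ← starRingEnd_apply]
      ring
    simp only [hnorm, Finset.mul_sum, Finset.sum_mul]
    rw [Finset.sum_comm (s := (Finset.univ : Finset (ZMod P)))]
    refine Finset.sum_congr rfl fun i _ => ?_
    rw [Finset.sum_comm (s := (Finset.univ : Finset (ZMod P)))]
    exact Finset.sum_congr rfl fun j _ => Finset.sum_congr rfl fun q _ => by ring
  have hP : (P : ℂ) ≠ 0 := Nat.cast_ne_zero.mpr (NeZero.ne P)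
  have hparseval : ∑ i, ‖v i‖ ^ 2 = (P : ℝ)⁻¹ * ∑ q, ‖w q‖ ^ 2 := by
    have h1 := hform 1
    have hdelta : ∀ i j, (P : ℂ)⁻¹ * ∑ q, (1 : ZMod P → ℂ) q *
        ZMod.stdAddChar (q * (θ i - θ j)) = if i = j then 1 else 0 := by
      intro i j
      simp only [Pi.one_apply, one_mul]
      rw [AddChar.sum_mulShift _ (ZMod.isPrimitive_stdAddChar P), ZMod.card]
      simp only [sub_eq_zero, hθ.eq_iff]
      split_ifs
      · exact inv_mul_cancel₀ hP
      · simp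
    simp only [hdelta] at h1
    simp only [ite_mul, one_mul, zero_mul, mul_ite, mul_zero, Finset.sum_ite_eq,
      Finset.mem_univ, if_true, Pi.one_apply] at h1
    have h2 : ∀ i, star (v i) * v i = ((‖v i‖ ^ 2 : ℝ) : ℂ) := fun i => by
      rw [Complex.ofReal_pow, ← Complex.conj_mul', starRingEnd_apply]
    simp only [h2] at h1
    apply Complex.ofReal_injective
    push_cast at h1 ⊢
    exact h1
  have hquad : (star v ⬝ᵥ ((Matrix.of fun i j =>
      (P : ℂ)⁻¹ * ∑ q, F q * ZMod.stdAddChar (q * (θ i - θ j))) *ᵥ v)).re =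
      (P : ℝ)⁻¹ * ∑ q, (F q).re * ‖w q‖ ^ 2 := by
    have h1 := hform F
    simp only [dotProduct, Matrix.mulVec, Pi.star_apply, Finset.mul_sum, Matrix.of_apply] at h1 ⊢
    rw [h1, ← Finset.mul_sum, ← Finset.mul_sum, ← Complex.ofReal_natCast, ← Complex.ofReal_inv,
      Complex.re_ofReal_mul, Complex.re_sum]
    congr 1
    exact Finset.sum_congr rfl fun q _ => Complex.re_mul_ofReal _ _
  rw [hquad, hparseval, mul_left_comm, Finset.mul_sum]
  gcongr with q
  exact hF q

/-- The `2L`-periodic extension of the coefficients `a_k`, `|k| < L`, with value `0` at `L`. -/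
noncomputable def periodizedCoeff (a : ℤ → ℂ) (L : ℕ) (t : ZMod (2 * L)) : ℂ :=
  ∑ k ∈ Finset.Ioo (-(L : ℤ)) L, if t = k then a k else 0

theorem periodizedCoeff_eq (a : ℤ → ℂ) {L : ℕ} {t : ZMod (2 * L)} {k : ℤ}
    (hk : k ∈ Finset.Ioo (-(L : ℤ)) L) (ht : t = k) : periodizedCoeff a L t = a k := by
  rw [periodizedCoeff, Finset.sum_eq_single k]
  · rw [if_pos ht]
  · intro j hj hjk
    refine if_neg fun h => hjk ?_
    rw [ht, ZMod.intCast_eq_intCast_iff_dvd_sub] at h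
    rw [Finset.mem_Ioo] at hj hk
    have h0 := Int.eq_zero_of_abs_lt_dvd h (by rw [abs_lt]; push_cast; constructor <;> linarith)
    linarith
  · exact fun h => absurd hk h

theorem periodizedCoeff_natCast_self (a : ℤ → ℂ) (L : ℕ) :
    periodizedCoeff a L (L : ZMod (2 * L)) = 0 := by
  refine Finset.sum_eq_zero fun j hj => if_neg fun h => ?_
  rw [Finset.mem_Ioo] at hj
  have h' : ((L : ℤ) : ZMod (2 * L)) = (j : ZMod (2 * L)) := by exact_mod_cast h
  rw [eq_comm, ZMod.intCast_eq_intCast_iff_dvd_sub] at h'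
  have h0 := Int.eq_zero_of_abs_lt_dvd h' (by rw [abs_lt]; push_cast; constructor <;> linarith)
  linarith

theorem periodizedCoeff_eq_zmod_fourier (a : ℤ → ℂ) (L : ℕ) [NeZero (2 * L)]
    (t : ZMod (2 * L)) :
    periodizedCoeff a L t = ((2 * L : ℕ) : ℂ)⁻¹ * ∑ q : ZMod (2 * L),
      truncatedSymbol a L ((q.val : ℝ) / ((2 * L : ℕ) : ℝ)) * ZMod.stdAddChar (q * t) := by
  have hP : ((2 * L : ℕ) : ℂ) ≠ 0 := Nat.cast_ne_zero.mpr (NeZero.ne _)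
  have hchar : ∀ (q : ZMod (2 * L)) (k : ℤ), Complex.exp (-(2 * (Real.pi : ℂ) * Complex.I *
      (((q.val : ℝ) / ((2 * L : ℕ) : ℝ) : ℝ) : ℂ) * (k : ℂ))) =
      ZMod.stdAddChar (-(q * (k : ZMod (2 * L)))) := by
    intro q k
    have hq : -(q * (k : ZMod (2 * L))) = ((-(q.val * k) : ℤ) : ZMod (2 * L)) := by
      push_cast
      rw [ZMod.natCast_zmod_val]
    rw [hq, ZMod.stdAddChar_coe]
    congr 1
    push_cast
    ring
  simp only [truncatedSymbol, hchar, Finset.sum_mul]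
  rw [Finset.sum_comm, periodizedCoeff, Finset.mul_sum]
  refine Finset.sum_congr rfl fun k _ => ?_
  have hterm : ∀ q : ZMod (2 * L), a k * ZMod.stdAddChar (-(q * (k : ZMod (2 * L)))) *
      ZMod.stdAddChar (q * t) = a k * ZMod.stdAddChar (q * (t - (k : ZMod (2 * L)))) := by
    intro q
    rw [mul_assoc, ← AddChar.map_add_eq_mul]
    congr 2
    ring
  simp only [hterm]
  rw [← Finset.mul_sum, AddChar.sum_mulShift _ (ZMod.isPrimitive_stdAddChar _), ZMod.card]
  simp only [sub_eq_zero]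
  split_ifs
  · field_simp
  · simp

theorem isCoercive_periodizedCoeff {ι : Type*} [Fintype ι] {a : ℤ → ℂ} {L : ℕ} (hL : 0 < L)
    {θ : ι → ZMod (2 * L)} (hθ : Function.Injective θ) {μ : ℝ}
    (hμ : ∀ ω, μ ≤ (truncatedSymbol a L ω).re) :
    Matrix.IsCoercive (Matrix.of fun i j => periodizedCoeff a L (θ i - θ j)) μ := by
  have : NeZero (2 * L) := ⟨by omega⟩
  simp only [periodizedCoeff_eq_zmod_fourier]
  exact isCoercive_of_zmod_fourier hθ fun q => hμ _

/-- `A_n` is a principal submatrix of the circulant matrix of size `2L` for every `L ≥ n`, so it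
inherits the coercivity of a larger, better approximating circulant matrix. -/
theorem isCoercive_toeplitzSection {a : ℤ → ℂ} {n L : ℕ} (hnL : n ≤ L) (hL : 0 < L) {μ : ℝ}
    (hμ : ∀ ω, μ ≤ (truncatedSymbol a L ω).re) : (toeplitzSection a n).IsCoercive μ := by
  have hθ : Function.Injective fun k : Fin n => ((k : ℕ) : ZMod (2 * L)) := by
    intro k l h
    have h' := (ZMod.natCast_eq_natCast_iff' _ _ _).mp h
    rw [Nat.mod_eq_of_lt (by omega), Nat.mod_eq_of_lt (by omega)] at h'
    exact Fin.ext h'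
  convert isCoercive_periodizedCoeff hL hθ hμ using 1
  ext k l
  rw [toeplitzSection, Matrix.of_apply, Matrix.of_apply]
  refine (periodizedCoeff_eq a ?_ ?_).symm
  · rw [Finset.mem_Ioo]
    omega
  · push_cast
    rfl

theorem circulantEmbedding_zero_eq {f : ℝ → ℝ} (n : ℕ) :
    circulantEmbedding (fourierCoefficient f) 0 n = Matrix.of fun i j =>
      periodizedCoeff (fourierCoefficient f) n
        (Sum.elim (fun k : Fin n => ((k : ℕ) : ZMod (2 * n)))
          (fun k : Fin n => ((n + k : ℕ) : ZMod (2 * n))) i -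
        Sum.elim (fun k : Fin n => ((k : ℕ) : ZMod (2 * n)))
          (fun k : Fin n => ((n + k : ℕ) : ZMod (2 * n))) j) := by
  have h2n : (n : ZMod (2 * n)) + n = 0 := by
    have := ZMod.natCast_self (2 * n)
    push_cast at this
    rw [← this]
    ring
  ext (k | k) (l | l)
  · simp only [circulantEmbedding, Matrix.fromBlocks_apply₁₁, toeplitzSection, Matrix.of_apply,
      Sum.elim_inl]
    refine (periodizedCoeff_eq _ ?_ ?_).symm
    · rw [Finset.mem_Ioo]
      omega
    · push_cast
      rfl
  · simp only [circulantEmbedding, Matrix.fromBlocks_apply₁₂, Matrix.conjTranspose_apply,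
      cornerBlock, Matrix.of_apply, Sum.elim_inl, Sum.elim_inr]
    rcases lt_trichotomy l k with h | rfl | h
    · have h' : (l : ℕ) < k := h
      rw [if_neg h.ne, if_pos h, ← fourierCoefficient_neg]
      refine (periodizedCoeff_eq _ ?_ ?_).symm
      · rw [Finset.mem_Ioo]
        omega
      · push_cast
        ring
    · rw [if_pos rfl, star_zero]
      rw [← periodizedCoeff_natCast_self (fourierCoefficient f) n]
      congr 1
      push_cast
      linear_combination h2n
    · have h' : (k : ℕ) < l := h
      rw [if_neg h.ne', if_neg h.not_gt, ← fourierCoefficient_neg]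
      refine (periodizedCoeff_eq _ ?_ ?_).symm
      · rw [Finset.mem_Ioo]
        omega
      · push_cast
        linear_combination -h2n
  · simp only [circulantEmbedding, Matrix.fromBlocks_apply₂₁,
      cornerBlock, Matrix.of_apply, Sum.elim_inl, Sum.elim_inr]
    rcases lt_trichotomy k l with h | rfl | h
    · have h' : (k : ℕ) < l := h
      rw [if_neg h.ne, if_pos h]
      refine (periodizedCoeff_eq _ ?_ ?_).symm
      · rw [Finset.mem_Ioo]
        omega
      · push_cast
        ring
    · rw [if_pos rfl]
      rw [← periodizedCoeff_natCast_self (fourierCoefficient f) n]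
      congr 1
      push_cast
      ring
    · have h' : (l : ℕ) < k := h
      rw [if_neg h.ne', if_neg h.not_gt]
      refine (periodizedCoeff_eq _ ?_ ?_).symm
      · rw [Finset.mem_Ioo]
        omega
      · push_cast
        linear_combination h2n
  · simp only [circulantEmbedding, Matrix.fromBlocks_apply₂₂, toeplitzSection, Matrix.of_apply,
      Sum.elim_inr]
    refine (periodizedCoeff_eq _ ?_ ?_).symm
    · rw [Finset.mem_Ioo]
      omega
    · push_cast
      ring

/-- For `b₀ = 0` the embedding is the circulant matrix of the truncated symbol; a nonzero `b₀`
perturbs it by one entry of modulus `|b₀|` in each row and column. -/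
theorem isCoercive_circulantEmbedding {f : ℝ → ℝ} {n : ℕ} (hn : 0 < n) {μ : ℝ}
    (hμ : ∀ ω, μ ≤ (truncatedSymbol (fourierCoefficient f) n ω).re) (b₀ : ℂ) :
    (circulantEmbedding (fourierCoefficient f) b₀ n).IsCoercive (μ - ‖b₀‖) := by
  have hθ : Function.Injective (Sum.elim (fun k : Fin n => ((k : ℕ) : ZMod (2 * n)))
      (fun k : Fin n => ((n + k : ℕ) : ZMod (2 * n)))) := by
    rintro (k | k) (l | l) h <;>
    · simp only [Sum.elim_inl, Sum.elim_inr] at h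
      have h' := (ZMod.natCast_eq_natCast_iff' _ _ _).mp h
      rw [Nat.mod_eq_of_lt (by omega), Nat.mod_eq_of_lt (by omega)] at h'
      first
      | exact congrArg _ (Fin.ext (by omega))
      | omega
  have h0 : (circulantEmbedding (fourierCoefficient f) 0 n).IsCoercive μ := by
    rw [circulantEmbedding_zero_eq]
    exact isCoercive_periodizedCoeff hn hθ hμ
  refine h0.of_entrywise_near (fun i j => if j = i.swap then ‖b₀‖ else 0) ?_ ?_ ?_
  · intro i j
    refine if_congr ⟨?_, ?_⟩ rfl rfl <;> rintro rfl <;> simp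
  · intro i
    simp
  · rintro (k | k) (l | l)
    · simp [circulantEmbedding]
    · by_cases h : l = k <;> simp [circulantEmbedding, cornerBlock, h]
    · by_cases h : k = l <;> simp [circulantEmbedding, cornerBlock, h, eq_comm]
    · simp [circulantEmbedding]

/-! ### Exponential decay of solutions of Toeplitz systems -/

/-- Row sums of the dominating matrix for the conjugated Toeplitz matrix: by `eˢ - 1 ≤ s eˢ` each
term is at most `δ` times a constant times `e^{-γ|k-l|/2}`, so the bound vanishes with `δ`. -/
theorem sum_conjugation_weight_le {c γ δ : ℝ} (hc : 0 ≤ c) (hγ : 0 < γ) (hδ : 0 ≤ δ)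
    (hδγ : δ ≤ γ / 4) {n : ℕ} (k : Fin n) :
    ∑ l : Fin n, c * Real.exp (-γ * |((k : ℕ) : ℝ) - (l : ℕ)|) *
      (Real.exp (δ * |((k : ℕ) : ℝ) - (l : ℕ)|) - 1) ≤
      δ * (4 * c / γ) * ∑' j : ℤ, Real.exp (-(γ / 2) * |(j : ℝ)|) := by
  have hterm : ∀ t : ℝ, 0 ≤ t → c * Real.exp (-γ * t) * (Real.exp (δ * t) - 1) ≤
      δ * (4 * c / γ) * Real.exp (-(γ / 2) * t) := by
    intro t ht
    have h1 : Real.exp (δ * t) - 1 ≤ δ * t * Real.exp (γ / 4 * t) := by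
      have h2 : Real.exp (δ * t) - 1 ≤ δ * t * Real.exp (δ * t) := by
        have h3 := Real.one_sub_le_exp_neg (δ * t)
        have h4 : Real.exp (-(δ * t)) * Real.exp (δ * t) = 1 := by
          rw [← Real.exp_add]; simp
        nlinarith [Real.exp_pos (δ * t)]
      refine h2.trans ?_
      gcongr
    have h5 : t ≤ 4 / γ * Real.exp (γ / 4 * t) := by
      have h6 := Real.add_one_le_exp (γ / 4 * t)
      calc t = 4 / γ * (γ / 4 * t) := by field_simp
        _ ≤ 4 / γ * Real.exp (γ / 4 * t) := by gcongr; linarith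
    calc c * Real.exp (-γ * t) * (Real.exp (δ * t) - 1)
        ≤ c * Real.exp (-γ * t) * (δ * (4 / γ * Real.exp (γ / 4 * t)) *
            Real.exp (γ / 4 * t)) := by
          gcongr
          exact h1.trans (by gcongr)
      _ = δ * (4 * c / γ) *
            (Real.exp (-γ * t) * Real.exp (γ / 4 * t) * Real.exp (γ / 4 * t)) := by ring
      _ = δ * (4 * c / γ) * Real.exp (-(γ / 2) * t) := by
          rw [← Real.exp_add, ← Real.exp_add]
          congr 2
          ring
  calc _ ≤ ∑ l : Fin n, δ * (4 * c / γ) *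
          Real.exp (-(γ / 2) * |((k : ℕ) : ℝ) - (l : ℕ)|) :=
        Finset.sum_le_sum fun l _ => hterm _ (abs_nonneg _)
    _ ≤ _ := by
        rw [← Finset.mul_sum]
        refine mul_le_mul_of_nonneg_left ?_ (by positivity)
        have hinj : Function.Injective fun l : Fin n => (k : ℤ) - (l : ℤ) := by
          intro l l' h
          exact Fin.ext (by simp only at h; omega)
        have h := tsum_comp_le_tsum_of_inj (summable_exp_neg_mul_abs (half_pos hγ))
          (fun _ => (Real.exp_pos _).le) hinj
        rw [tsum_fintype] at h
        simpa using h

/-- Conjugation by the diagonal matrix `e^{δφ}` with a `1`-Lipschitz weight `φ` changes the entries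
of a Toeplitz matrix with exponentially decaying coefficients only slightly, so the conjugated
matrix stays coercive and the solution of `A x = y` inherits the weighted decay of `y`. -/
theorem weighted_norm_apply_le {a : ℤ → ℂ} {c γ δ μ η : ℝ} (hδ : 0 ≤ δ)
    (ha : ∀ k : ℤ, ‖a k‖ ≤ c * Real.exp (-γ * |(k : ℝ)|)) {n : ℕ}
    (hA : (toeplitzSection a n).IsCoercive μ)
    (hη : ∀ k : Fin n, ∑ l : Fin n, c * Real.exp (-γ * |((k : ℕ) : ℝ) - (l : ℕ)|) *
      (Real.exp (δ * |((k : ℕ) : ℝ) - (l : ℕ)|) - 1) ≤ η)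
    (φ : Fin n → ℝ) (hφ : ∀ k l, |φ k - φ l| ≤ |((k : ℕ) : ℝ) - (l : ℕ)|)
    {x y : Fin n → ℂ} (hx : toeplitzSection a n *ᵥ x = y) (hμ : η ≤ μ) (k : Fin n) :
    (μ - η) * (Real.exp (δ * φ k) * ‖x k‖) ≤
      ‖WithLp.toLp 2 (fun l => (Real.exp (δ * φ l) : ℂ) * y l)‖ := by
  set A' : Matrix (Fin n) (Fin n) ℂ := Matrix.of fun k l =>
    (Real.exp (δ * (φ k - φ l)) : ℂ) * toeplitzSection a n k l
  have hcoer : A'.IsCoercive (μ - η) := by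
    refine hA.of_entrywise_near (fun k l => c * Real.exp (-γ * |((k : ℕ) : ℝ) - (l : ℕ)|) *
      (Real.exp (δ * |((k : ℕ) : ℝ) - (l : ℕ)|) - 1)) ?_ hη ?_
    · intro i j
      simp only [abs_sub_comm]
    · intro i j
      have h1 : A' i j - toeplitzSection a n i j =
          ((Real.exp (δ * (φ i - φ j)) - 1 : ℝ) : ℂ) * a ((i : ℤ) - (j : ℤ)) := by
        simp only [A', toeplitzSection, Matrix.of_apply]
        push_cast
        ring
      have h2 : |Real.exp (δ * (φ i - φ j)) - 1| ≤
          Real.exp (δ * |((i : ℕ) : ℝ) - (j : ℕ)|) - 1 := by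
        set s := δ * (φ i - φ j)
        have hs : |s| ≤ δ * |((i : ℕ) : ℝ) - (j : ℕ)| := by
          rw [abs_mul, abs_of_nonneg hδ]
          exact mul_le_mul_of_nonneg_left (hφ i j) hδ
        have hsexp := Real.exp_le_exp.mpr hs
        rw [abs_le]
        constructor
        · have h3 := Real.add_one_le_exp s
          have h4 := Real.add_one_le_exp |s|
          have h5 := neg_abs_le s
          linarith
        · have h3 := Real.exp_le_exp.mpr (le_abs_self s)
          linarith
      rw [h1, norm_mul, Complex.norm_real, Real.norm_eq_abs, mul_comm]
      have h6 := ha ((i : ℤ) - (j : ℤ))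
      push_cast at h6
      exact mul_le_mul h6 h2 (abs_nonneg _) ((norm_nonneg _).trans h6)
  have hconj : A' *ᵥ (fun l => (Real.exp (δ * φ l) : ℂ) * x l) =
      fun l => (Real.exp (δ * φ l) : ℂ) * y l := by
    funext i
    rw [← hx]
    simp only [Matrix.mulVec, dotProduct, A', Matrix.of_apply, Finset.mul_sum]
    refine Finset.sum_congr rfl fun j _ => ?_
    have hexp : (Real.exp (δ * φ i) : ℂ) =
        (Real.exp (δ * (φ i - φ j)) : ℂ) * (Real.exp (δ * φ j) : ℂ) := by
      rw [← Complex.ofReal_mul, ← Real.exp_add]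
      congr 2
      ring
    rw [hexp]
    ring
  rw [← hconj]
  refine le_trans ?_ (hcoer.norm_le _)
  refine mul_le_mul_of_nonneg_left ?_ (sub_nonneg.mpr hμ)
  refine le_trans (le_of_eq ?_) (norm_apply_le_norm_toLp _ k)
  rw [norm_mul, Complex.norm_real, Real.norm_eq_abs, abs_of_pos (Real.exp_pos _)]

theorem norm_cornerBlock_le {a : ℤ → ℂ} {c γ : ℝ} (hc : 0 ≤ c)
    (ha : ∀ k : ℤ, ‖a k‖ ≤ c * Real.exp (-γ * |(k : ℝ)|)) {n : ℕ} {b₀ : ℂ}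
    (hb : b₀ = a n ∨ b₀ = 0) (k l : Fin n) :
    ‖cornerBlock a b₀ n k l‖ ≤
      c * Real.exp (-γ * ((n : ℝ) - |((k : ℕ) : ℝ) - (l : ℕ)|)) := by
  have hk : ((k : ℕ) : ℝ) < n := by exact_mod_cast k.2
  have hl : ((l : ℕ) : ℝ) < n := by exact_mod_cast l.2
  have hk0 : (0 : ℝ) ≤ (k : ℕ) := by positivity
  have hl0 : (0 : ℝ) ≤ (l : ℕ) := by positivity
  rw [cornerBlock, Matrix.of_apply]
  rcases lt_trichotomy k l with h | rfl | h
  · have h' : ((k : ℕ) : ℝ) < (l : ℕ) := by exact_mod_cast h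
    rw [if_neg h.ne, if_pos h]
    refine (ha _).trans (le_of_eq ?_)
    push_cast
    rw [abs_of_neg (sub_neg.mpr h'), abs_of_pos (by linarith)]
    congr 3
    ring
  · rw [if_pos rfl]
    rcases hb with rfl | rfl
    · simpa using ha n
    · rw [norm_zero]
      positivity
  · have h' : ((l : ℕ) : ℝ) < (k : ℕ) := by exact_mod_cast h
    rw [if_neg h.ne', if_neg h.not_gt]
    refine (ha _).trans (le_of_eq ?_)
    push_cast
    rw [abs_of_pos (sub_pos.mpr h'), abs_of_neg (by linarith)]
    congr 3
    ring

/-- The entries of `B_n` concentrate in two corners while `x` concentrates in the middle of the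
index range, so `B_n x` is of order `e^{-δn/2}`: with `d = |n/2 - l|` one has
`n - |k - l| ≥ n/2 - d`. -/
theorem norm_cornerBlock_mulVec_le {a : ℤ → ℂ} {c γ δ : ℝ} (hc : 0 ≤ c) (hδ : 0 ≤ δ)
    (hδγ : δ ≤ γ) (ha : ∀ k : ℤ, ‖a k‖ ≤ c * Real.exp (-γ * |(k : ℝ)|)) {n : ℕ} {b₀ : ℂ}
    (hb : b₀ = a n ∨ b₀ = 0) {x : Fin n → ℂ} {C : ℝ} (hC : 0 ≤ C)
    (hx : ∀ l : Fin n, Real.exp (δ * |(n : ℝ) / 2 - ((l : ℕ) : ℝ)|) * ‖x l‖ ≤ C) :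
    ‖WithLp.toLp 2 (cornerBlock a b₀ n *ᵥ x)‖ ≤
      n * (n * (c * C * Real.exp (-(δ / 2) * n))) := by
  refine norm_toLp_le_card_mul _ (by positivity) fun k => ?_
  calc ‖(cornerBlock a b₀ n *ᵥ x) k‖
      ≤ ∑ l, ‖cornerBlock a b₀ n k l * x l‖ := by
        rw [Matrix.mulVec, dotProduct]
        exact norm_sum_le _ _
    _ ≤ ∑ _l : Fin n, c * C * Real.exp (-(δ / 2) * n) := by
        refine Finset.sum_le_sum fun l _ => ?_
        have hk : ((k : ℕ) : ℝ) < n := by exact_mod_cast k.2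
        have hl : ((l : ℕ) : ℝ) < n := by exact_mod_cast l.2
        have hk0 : (0 : ℝ) ≤ (k : ℕ) := by positivity
        have hl0 : (0 : ℝ) ≤ (l : ℕ) := by positivity
        set d := |(n : ℝ) / 2 - ((l : ℕ) : ℝ)|
        have hd1 : (n : ℝ) / 2 - ((l : ℕ) : ℝ) ≤ d := le_abs_self _
        have hd2 : -((n : ℝ) / 2 - ((l : ℕ) : ℝ)) ≤ d := neg_le_abs _
        have hkl : |((k : ℕ) : ℝ) - (l : ℕ)| ≤ n / 2 + d := by
          rw [abs_le]; constructor <;> linarith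
        have hkl' : |((k : ℕ) : ℝ) - (l : ℕ)| ≤ n := by
          rw [abs_le]; constructor <;> linarith
        have hB : ‖cornerBlock a b₀ n k l‖ ≤
            c * (Real.exp (-(δ / 2) * n) * Real.exp (δ * d)) := by
          refine (norm_cornerBlock_le hc ha hb k l).trans ?_
          rw [← Real.exp_add]
          gcongr
          nlinarith
        rw [norm_mul]
        calc ‖cornerBlock a b₀ n k l‖ * ‖x l‖
            ≤ c * (Real.exp (-(δ / 2) * n) * Real.exp (δ * d)) * ‖x l‖ := by gcongr
          _ = c * (Real.exp (δ * d) * ‖x l‖) * Real.exp (-(δ / 2) * n) := by ring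
          _ ≤ c * C * Real.exp (-(δ / 2) * n) := by gcongr; exact hx l
    _ = n * (c * C * Real.exp (-(δ / 2) * n)) := by simp

/-! ### The error bound -/

theorem nat_cube_mul_exp_le {δ : ℝ} (hδ : 0 < δ) (n : ℕ) :
    (n : ℝ) ^ 3 * Real.exp (-(δ / 2) * n) ≤ 6 * (4 / δ) ^ 3 * Real.exp (-(δ / 4) * n) := by
  have h := Real.pow_div_factorial_le_exp (δ / 4 * n) (by positivity) 3
  have h1 : (n : ℝ) ^ 3 ≤ 6 * (4 / δ) ^ 3 * Real.exp (δ / 4 * n) := by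
    calc (n : ℝ) ^ 3 = 6 * (4 / δ) ^ 3 * ((δ / 4 * n) ^ 3 / (Nat.factorial 3 : ℝ)) := by
          norm_num [Nat.factorial]
          field_simp
      _ ≤ _ := by gcongr
  calc (n : ℝ) ^ 3 * Real.exp (-(δ / 2) * n)
      ≤ 6 * (4 / δ) ^ 3 * Real.exp (δ / 4 * n) * Real.exp (-(δ / 2) * n) := by gcongr
    _ = 6 * (4 / δ) ^ 3 * Real.exp (-(δ / 4) * n) := by
        rw [mul_assoc, ← Real.exp_add]
        congr 2
        ring

/-- The error bound with the norm `κ` of the inverse of `C_{2n}` as a factor, and a bound `2/m` for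
`κ` when `n` is large. All constants depend on `m`, `c` and `γ` only. -/
theorem exists_uniform_embedding_bound {m c γ : ℝ} (hm : 0 < m) (hc : 0 < c) (hγ : 0 < γ) :
    ∃ δ : ℝ, 0 < δ ∧ δ < γ ∧ ∃ W : ℝ, 0 ≤ W ∧ ∃ N : ℕ, ∀ (f : ℝ → ℝ) (M : ℝ),
      IsExpDecaySymbol f m M c γ → ∀ (n : ℕ) (b₀ : ℂ), b₀ = fourierCoefficient f n ∨ b₀ = 0 →
        (IsUnit (circulantEmbedding (fourierCoefficient f) b₀ n) → ∀ κ : ℝ, 0 ≤ κ →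
          (∀ v, ‖WithLp.toLp 2 v‖ ≤
            κ * ‖WithLp.toLp 2 (circulantEmbedding (fourierCoefficient f) b₀ n *ᵥ v)‖) →
          ∀ c' : ℝ, 0 ≤ c' → ∀ x y z : Fin n → ℂ,
            (∀ k : Fin n, ‖y k‖ ≤ c' * Real.exp (-γ * |(n : ℝ) / 2 - ((k : ℕ) : ℝ)|)) →
            toeplitzSection (fourierCoefficient f) n *ᵥ x = y →
            embeddingApprox (fourierCoefficient f) b₀ n *ᵥ z = y →
            ‖WithLp.toLp 2 (x - z)‖ ≤ c' * (κ * W) * Real.exp (-δ * (n : ℝ))) ∧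
        (N ≤ n → ∀ v, ‖WithLp.toLp 2 v‖ ≤ 2 / m *
          ‖WithLp.toLp 2 (circulantEmbedding (fourierCoefficient f) b₀ n *ᵥ v)‖) := by
  set G : ℝ := ∑' j : ℤ, Real.exp (-(γ / 2) * |(j : ℝ)|) with hG
  have hG1 : 1 ≤ G := by
    have h := (summable_exp_neg_mul_abs (half_pos hγ)).le_tsum 0
      (fun _ _ => (Real.exp_pos _).le)
    simpa [hG] using h
  -- With this rate the conjugated Toeplitz matrix loses at most `m/4` of coercivity.
  set δ : ℝ := min (γ / 4) (m * γ / (16 * c * G)) with hδdef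
  have hδ : 0 < δ := lt_min (by positivity) (by positivity)
  have hδγ : δ ≤ γ / 4 := min_le_left _ _
  have hδm : δ * (4 * c / γ) * G ≤ m / 4 := by
    calc δ * (4 * c / γ) * G ≤ m * γ / (16 * c * G) * (4 * c / γ) * G := by
          gcongr
          exact min_le_right _ _
      _ = m / 4 := by field_simp; norm_num
  -- Beyond `N` both the truncation error of the symbol and `|b₀|` are at most `m/4`.
  obtain ⟨N, hN0, hN⟩ : ∃ N : ℕ, 0 < N ∧
      ∀ n ≥ N, c * Real.exp (-(γ / 2) * n) * G ≤ m / 4 := by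
    have hlim : Filter.Tendsto (fun n : ℕ => c * Real.exp (-(γ / 2) * n) * G) Filter.atTop
        (nhds (c * 0 * G)) := by
      refine ((Real.tendsto_exp_atBot.comp ?_).const_mul c).mul_const G
      exact tendsto_natCast_atTop_atTop.const_mul_atTop_of_neg (by linarith)
    rw [mul_zero, zero_mul] at hlim
    obtain ⟨N, hN⟩ := Filter.eventually_atTop.mp
      (hlim.eventually_le_const (by positivity : (0 : ℝ) < m / 4))
    exact ⟨N + 1, N.succ_pos, fun n hn => hN n (by omega)⟩
  refine ⟨δ / 4, by positivity, by linarith, 6 * (4 / δ) ^ 3 * (2 * c / m), by positivity, N,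
    fun f M hf n b₀ hb => ?_⟩
  have hsymbol : ∀ L ≥ N, ∀ ω,
      3 * m / 4 ≤ (truncatedSymbol (fourierCoefficient f) L ω).re := by
    intro L hL ω
    have h1 := (norm_sub_truncatedSymbol_le hf.continuous hf.periodic hc.le hγ hf.decay L ω).trans
      (hN L hL)
    have h2 := (Complex.re_le_norm _).trans h1
    have h3 : m ≤ f ω := hf.isLeast.2 ⟨ω, rfl⟩
    rw [Complex.sub_re, Complex.ofReal_re] at h2
    linarith
  have hA : (toeplitzSection (fourierCoefficient f) n).IsCoercive (3 * m / 4) :=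
    isCoercive_toeplitzSection (le_max_left n N) (lt_max_of_lt_right hN0)
      (hsymbol _ (le_max_right n N))
  refine ⟨fun hC κ hκ0 hκ c' hc' x y z hy hx hz => ?_, fun hn v => ?_⟩
  · have hweight : ∀ l : Fin n, Real.exp (δ * |(n : ℝ) / 2 - ((l : ℕ) : ℝ)|) * ‖x l‖ ≤
        2 / m * (n * c') := by
      intro l
      have h1 := weighted_norm_apply_le (δ := δ) (η := m / 4) hδ.le hf.decay hA
        (fun k => (sum_conjugation_weight_le hc.le hγ hδ.le hδγ k).trans hδm)
        (fun k => |(n : ℝ) / 2 - ((k : ℕ) : ℝ)|)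
        (fun k l => (abs_abs_sub_abs_le_abs_sub _ _).trans_eq (by
          rw [sub_sub_sub_cancel_left, abs_sub_comm])) hx (by linarith) l
      have h2 : ‖WithLp.toLp 2 (fun k : Fin n =>
          (Real.exp (δ * |(n : ℝ) / 2 - ((k : ℕ) : ℝ)|) : ℂ) * y k)‖ ≤ n * c' := by
        refine norm_toLp_le_card_mul _ hc' fun k => ?_
        rw [norm_mul, Complex.norm_real, Real.norm_eq_abs, abs_of_pos (Real.exp_pos _)]
        set d := |(n : ℝ) / 2 - ((k : ℕ) : ℝ)|
        have hd : 0 ≤ d := abs_nonneg _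
        calc Real.exp (δ * d) * ‖y k‖ ≤ Real.exp (δ * d) * (c' * Real.exp (-γ * d)) := by
              gcongr
              exact hy k
          _ = c' * Real.exp (δ * d + -γ * d) := by rw [Real.exp_add]; ring
          _ ≤ c' * 1 := by
              gcongr
              rw [Real.exp_le_one_iff]
              nlinarith
          _ = c' := mul_one _
      have h3 := h1.trans h2
      rw [show 3 * m / 4 - m / 4 = m / 2 by ring] at h3
      rw [div_mul_eq_mul_div, le_div_iff₀ hm]
      linarith
    refine (norm_sub_le_of_circulantEmbedding hC
      (fun v hv => hA.mulVec_eq_zero (by positivity) hv) hκ hx hz).trans ?_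
    calc κ * ‖WithLp.toLp 2 (cornerBlock (fourierCoefficient f) b₀ n *ᵥ x)‖
        ≤ κ * (n * (n * (c * (2 / m * (n * c')) * Real.exp (-(δ / 2) * n)))) := by
          gcongr
          exact norm_cornerBlock_mulVec_le hc.le hδ.le (by linarith) hf.decay hb (by positivity)
            hweight
      _ = κ * (2 * c / m) * c' * ((n : ℝ) ^ 3 * Real.exp (-(δ / 2) * n)) := by ring
      _ ≤ κ * (2 * c / m) * c' * (6 * (4 / δ) ^ 3 * Real.exp (-(δ / 4) * n)) := by
          exact mul_le_mul_of_nonneg_left (nat_cube_mul_exp_le hδ n) (by positivity)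
      _ = _ := by ring
  · have hb₀ : ‖b₀‖ ≤ m / 4 := by
      rcases hb with rfl | rfl
      · refine le_trans ?_ (hN n hn)
        refine (hf.decay n).trans ?_
        rw [mul_assoc]
        gcongr
        refine le_trans ?_ (le_mul_of_one_le_right (Real.exp_pos _).le hG1)
        rw [Int.cast_natCast, Nat.abs_cast, Real.exp_le_exp]
        have : (0 : ℝ) ≤ n := n.cast_nonneg
        nlinarith
      · rw [norm_zero]
        positivity
    have h1 := (isCoercive_circulantEmbedding (hN0.trans_le hn) (hsymbol n hn) b₀).norm_le v
    have h2 : m / 2 * ‖WithLp.toLp 2 v‖ ≤ (3 * m / 4 - ‖b₀‖) * ‖WithLp.toLp 2 v‖ := by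
      gcongr
      linarith
    rw [div_mul_eq_mul_div, le_div_iff₀ hm]
    linarith

theorem IsExpDecaySymbol.mono {f : ℝ → ℝ} {m M c c₀ γ : ℝ} (hf : IsExpDecaySymbol f m M c γ)
    (hc : c ≤ c₀) : IsExpDecaySymbol f m M c₀ γ where
  continuous := hf.continuous
  periodic := hf.periodic
  isLeast := hf.isLeast
  isGreatest := hf.isGreatest
  decay k := (hf.decay k).trans (by gcongr)

/-- The constant `γ₁⁻¹` absorbs any given constant `W` once the rate `γ₁` is chosen small. -/
theorem exists_rate_absorbing {δ W : ℝ} (hδ : 0 < δ) (hW : 0 ≤ W) :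
    ∃ γ₁ : ℝ, 0 < γ₁ ∧ γ₁ ≤ δ ∧ W ≤ γ₁⁻¹ := by
  refine ⟨min δ (W + 1)⁻¹, lt_min hδ (by positivity), min_le_left _ _, ?_⟩
  have h : (min δ (W + 1)⁻¹)⁻¹ ≥ ((W + 1)⁻¹)⁻¹ :=
    inv_anti₀ (lt_min hδ (by positivity)) (min_le_right _ _)
  rw [inv_inv] at h
  linarith

theorem mainTheorem4 :
    ∃ K : ℝ → ℝ → ℝ → ℝ, ∀ (m M c γ : ℝ), 0 < m → 0 < γ →
      (∀ f : ℝ → ℝ, IsExpDecaySymbol f m M c γ →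
        ∃ γ₁ : ℝ, 0 < γ₁ ∧ γ₁ < γ ∧
          ∀ n : ℕ, EmbeddingErrorBound f γ γ₁ (K m M γ₁) n) ∧
      (∃ γ₁ : ℝ, 0 < γ₁ ∧ γ₁ < γ ∧ ∃ N : ℕ,
        ∀ f : ℝ → ℝ, IsExpDecaySymbol f m M c γ →
          ∀ n : ℕ, N ≤ n → EmbeddingErrorBound f γ γ₁ (K m M γ₁) n) := by
  refine ⟨fun _ _ γ₁ => γ₁⁻¹, fun m M c γ hm hγ => ?_⟩
  -- No sign is assumed for `c`, so it is replaced by a positive constant.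
  obtain ⟨δ, hδ, hδγ, W, hW, N, h⟩ :=
    exists_uniform_embedding_bound hm (by positivity : 0 < |c| + 1) hγ
  have hcc : c ≤ |c| + 1 := (le_abs_self c).trans (by linarith)
  have habsorb : ∀ {γ₁ κ c' e : ℝ} {n : ℕ}, 0 ≤ c' → κ * W ≤ γ₁⁻¹ → 0 < γ₁ → γ₁ ≤ δ →
      e ≤ c' * (κ * W) * Real.exp (-δ * (n : ℝ)) →
      e ≤ c' * γ₁⁻¹ * Real.exp (-γ₁ * (n : ℝ)) := by
    intro γ₁ κ c' e n hc' hκ hγ₁ hle he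
    refine he.trans ?_
    gcongr
  refine ⟨fun f hf => ?_, ?_⟩
  · -- For `n < N` no uniform bound on the inverse is available, but there are finitely many cases.
    have hκ : ∀ n : ℕ, ∃ κ : ℝ, 0 ≤ κ ∧ ∀ b₀ : ℂ, b₀ = fourierCoefficient f n ∨ b₀ = 0 →
        IsUnit (circulantEmbedding (fourierCoefficient f) b₀ n) → ∀ v, ‖WithLp.toLp 2 v‖ ≤
          κ * ‖WithLp.toLp 2 (circulantEmbedding (fourierCoefficient f) b₀ n *ᵥ v)‖ := by
      intro n
      have hone : ∀ b₀ : ℂ, ∃ κ : ℝ, 0 ≤ κ ∧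
          (IsUnit (circulantEmbedding (fourierCoefficient f) b₀ n) → ∀ v, ‖WithLp.toLp 2 v‖ ≤
            κ * ‖WithLp.toLp 2 (circulantEmbedding (fourierCoefficient f) b₀ n *ᵥ v)‖) := by
        intro b₀
        by_cases hu : IsUnit (circulantEmbedding (fourierCoefficient f) b₀ n)
        · obtain ⟨κ, h0, h1⟩ := exists_norm_le_of_isUnit hu
          exact ⟨κ, h0, fun _ => h1⟩
        · exact ⟨0, le_rfl, fun h1 => absurd h1 hu⟩
      choose κ hκ0 hκ1 using hone
      refine ⟨κ (fourierCoefficient f n) + κ 0, add_nonneg (hκ0 _) (hκ0 _), ?_⟩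
      rintro b₀ (rfl | rfl) hu v
      · refine (hκ1 _ hu v).trans ?_
        gcongr
        linarith [hκ0 0]
      · refine (hκ1 _ hu v).trans ?_
        gcongr
        linarith [hκ0 (fourierCoefficient f n)]
    choose κ hκ0 hκ1 using hκ
    set κ₀ : ℝ := 2 / m + ∑ n ∈ Finset.range N, κ n
    have hsum : 0 ≤ ∑ n ∈ Finset.range N, κ n := Finset.sum_nonneg fun n _ => hκ0 n
    have hκ₀ : 0 ≤ κ₀ := by positivity
    obtain ⟨γ₁, hγ₁, hle, habs⟩ := exists_rate_absorbing hδ (mul_nonneg hκ₀ hW)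
    refine ⟨γ₁, hγ₁, hle.trans_lt hδγ, fun n b₀ hb hu c' hc' x y z hy hx hz => ?_⟩
    obtain ⟨h1, h2⟩ := h f M (hf.mono hcc) n b₀ hb
    refine habsorb hc' habs hγ₁ hle (h1 hu κ₀ hκ₀ (fun v => ?_) c' hc' x y z hy hx hz)
    rcases le_or_gt N n with hn | hn
    · refine (h2 hn v).trans ?_
      gcongr
      linarith
    · refine (hκ1 n b₀ hb hu v).trans ?_
      gcongr
      have h3 := Finset.single_le_sum (fun i _ => hκ0 i) (Finset.mem_range.mpr hn)
      have h4 : 0 < 2 / m := by positivity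
      linarith
  · have h2m : 0 ≤ 2 / m := by positivity
    obtain ⟨γ₁, hγ₁, hle, habs⟩ := exists_rate_absorbing hδ (mul_nonneg h2m hW)
    refine ⟨γ₁, hγ₁, hle.trans_lt hδγ, N, fun f hf n hn b₀ hb hu c' hc' x y z hy hx hz => ?_⟩
    obtain ⟨h1, h2⟩ := h f M (hf.mono hcc) n b₀ hb
    exact habsorb hc' habs hγ₁ hle (h1 hu _ h2m (h2 hn) c' hc' x y z hy hx hz)
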